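/- Let $m,q\ge 1$, $M=mq$, let $Q$ be a probability measure on $(S^m)^q$, $S^m\subset\mathbb R^{m+1}$ the unit sphere, and let $y_1,y_2,\dots$ be i.i.d. with law $Q$, $y_r=(y_r^1,\dots,y_r^q)$. Put $\mu^a=E[y_1^a]$ and assume $\mu^a\neq 0$ for $a=1,\dots,q$, so that the mean multivariate direction $\mu_D=(\mu^1/\|\mu^1\|,\dots,\mu^q/\|\mu^q\|)$ exists. Assume also that the tangential part of $Q$ at $\mu_D$ is nondegenerate: if $v_1,\dots,v_q\in\mathbb R^{m+1}$ satisfy $v_a^T\mu^a=0$ for all $a$ and $\sum_a v_a^Ty^a=0$ for $Q$-almost every $y$, then all $v_a=0$. For each $a$ let $(e_{a,1},\dots,e_{a,m})$ be a continuous orthonormal frame field of tangent vectors of $S^m$, defined on an open neighbourhood $U_a$ of $\mu^a/\|\mu^a\|$ in $S^m$. For $n\ge1$ let $\bar y^a=\frac1n\sum_{r=1}^n y_r^a$, $\bar y_D=(\bar y^1/\|\bar y^1\|,\dots,\bar y^q/\|\bar y^q\|)$, and let $G(y)$ be the $M\times M$ matrix with entries $$G(y)_{(a,i),(b,j)}=\frac{1}{n\,\|\bar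 y^a\|\,\|\bar y^b\|}\sum_{r=1}^n\Big(e_{a,i}\big(\tfrac{\bar y^a}{\|\bar y^a\|}\big)^Ty_r^a\Big)\Big(e_{b,j}\big(\tfrac{\bar y^b}{\|\bar y^b\|}\big)^Ty_r^b\Big),\qquad 1\le a,b\le q,\ 1\le i,j\le m .$$ Decompose the difference of the directional means into its tangential and normal components at $\mu_D$: for $a=1,\dots,q$, $$\frac{\bar y^a}{\|\bar y^a\|}-\frac{\mu^a}{\|\mu^a\|}=\sum_{j=1}^m d_{a,j}\,e_{a,j}\Big(\frac{\mu^a}{\|\mu^a\|}\Big)+\nu_a ,$$ where $\nu_a$ is orthogonal to the tangent space of $S^m$ at $\mu^a/\|\mu^a\|$, and put $d=(d_{a,j})\in\mathbb R^M$. Then the probability that $T^2=n\,d^TG(y)^{-1}d$ is defined (that is, $\bar y^a\ne0$ and $\bar y^a/\|\bar y^a\|\in U_a$ for all $a$, and $G(y)$ is invertible) tends to $1$ as $n\to\infty$, and $T^2$, set to $0$ where it is not defined, converges weakly to $\chi^2_M$, the law of the sum of squares of $M$ independent standard normal variables. -/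

import Mathlib

open MeasureTheory ProbabilityTheory Filter Topology

noncomputable section

namespace DirectionalStat

/-- The ambient Euclidean space of the unit sphere `S^m`. -/
abbrev Amb (m : ℕ) : Type := EuclideanSpace ℝ (Fin (m + 1))

/-- The unit sphere `S^m` in `ℝ^(m+1)`. -/
abbrev Sph (m : ℕ) : Type := Metric.sphere (0 : Amb m) 1

/-- The law of the sum of squares of `M` independent standard normal variables. -/
def chiSquared (M : ℕ) : Measure ℝ :=
  (Measure.pi fun _ : Fin M => gaussianReal 0 1).map fun x => ∑ i, x i ^ 2

instance isProbabilityMeasure_chiSquared (M : ℕ) : IsProbabilityMeasure (chiSquared M) :=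
  Measure.isProbabilityMeasure_map
    (Finset.measurable_sum _ fun i _ => (measurable_pi_apply i).pow_const 2).aemeasurable

/-- The tuple `(e 1, …, e m)` is a continuous orthonormal frame field of the tangent bundle of
`S^m` over the part of `S^m` that lies in `U`. -/
structure IsOrthonormalFrameOn {m : ℕ} (U : Set (Amb m)) (e : Fin m → Amb m → Amb m) : Prop where
  continuousOn : ∀ i, ContinuousOn (e i) (U ∩ Metric.sphere 0 1)
  tangent : ∀ x ∈ U ∩ Metric.sphere 0 1, ∀ i, inner ℝ (e i x) x = 0
  orthonormal : ∀ x ∈ U ∩ Metric.sphere 0 1, Orthonormal ℝ fun i => e i x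

variable {m q : ℕ}

/-- The `a`-th component `μ^a = E[y^a]` of the mean vector of a distribution on `(S^m)^q`. -/
def meanVec (Q : Measure (Fin q → Sph m)) (a : Fin q) : Amb m :=
  ∫ y, (y a : Amb m) ∂Q

/-- The `a`-th component `μ^a / ‖μ^a‖` of the mean multivariate direction. -/
def meanDir (Q : Measure (Fin q → Sph m)) (a : Fin q) : Amb m :=
  ‖meanVec Q a‖⁻¹ • meanVec Q a

/-- The `a`-th component of the sample mean vector of the first `n` observations. -/
def sampleMean (y : ℕ → Fin q → Sph m) (n : ℕ) (a : Fin q) : Amb m :=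
  (n : ℝ)⁻¹ • ∑ r ∈ Finset.range n, (y r a : Amb m)

/-- The `a`-th component of the directional sample mean. -/
def sampleDir (y : ℕ → Fin q → Sph m) (n : ℕ) (a : Fin q) : Amb m :=
  ‖sampleMean y n a‖⁻¹ • sampleMean y n a

/-- The studentizing matrix `G(y)` built from the frame field at the directional sample mean. -/
def studG (e : Fin q → Fin m → Amb m → Amb m) (y : ℕ → Fin q → Sph m) (n : ℕ) :
    Matrix (Fin q × Fin m) (Fin q × Fin m) ℝ :=
  Matrix.of fun s t =>
    (n : ℝ)⁻¹ * (‖sampleMean y n s.1‖ * ‖sampleMean y n t.1‖)⁻¹ *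
      ∑ r ∈ Finset.range n,
        inner ℝ (e s.1 s.2 (sampleDir y n s.1)) (y r s.1 : Amb m) *
          inner ℝ (e t.1 t.2 (sampleDir y n t.1)) (y r t.1 : Amb m)

/-- All objects in the definition of the statistic make sense: the directional sample mean exists
and lies in the domain of the frame field, and `G(y)` is invertible. -/
def StatDefined (U : Fin q → Set (Amb m)) (e : Fin q → Fin m → Amb m → Amb m)
    (y : ℕ → Fin q → Sph m) (n : ℕ) : Prop :=
  (∀ a, sampleMean y n a ≠ 0 ∧ sampleDir y n a ∈ U a) ∧ IsUnit (studG e y n).det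

/-- The value `n · dᵀ G(y)⁻¹ d`. -/
def studStat (e : Fin q → Fin m → Amb m → Amb m) (y : ℕ → Fin q → Sph m) (n : ℕ)
    (d : Fin q × Fin m → ℝ) : ℝ :=
  n * dotProduct d ((studG e y n)⁻¹.mulVec d)

end DirectionalStat

end

/-! No delta method is needed, because the random norms cancel exactly. Let `T` be the sum over the
sample of the tangential coordinates taken in the frames at the mean direction, and let `C` be the
diagonal matrix of the `‖ȳ^a‖⁻¹`. Frame vectors at `μ_D` are orthogonal to `μ_D` and to the normal
part `ν`, so `d = C (T/n)`; likewise `G(y) = C Ĝ C`, with `Ĝ` the empirical second moment matrix in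
the frames at the sample direction. Hence `T² = (T/√n)ᵀ Ĝ⁻¹ (T/√n)` (`studStat_eq`).

The summands of `T` are bounded, i.i.d. and centred, with covariance `S = tangentCov Q e`, which
nondegeneracy makes positive definite (`posDef_tangentCov`). The strong law and continuity of the
frames give `Ĝ → S` almost surely (`tendsto_tangentGram`), so the statistic is almost surely
eventually defined. The central limit theorem and Slutsky's lemma give the limit `zᵀ S⁻¹ z` with `z
~ N(0, S)`, which is `‖w‖²` for `w` standard Gaussian (`tendstoInDistribution_studentized`). -/

namespace DirectionalStat

/-! ### Multivariate central limit theorem -/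

section CentralLimit

variable {Ω Ω' : Type*} [MeasurableSpace Ω] [MeasurableSpace Ω']
  {P : Measure Ω} [IsProbabilityMeasure P] {P' : Measure Ω'} [IsProbabilityMeasure P']

/-- The multivariate central limit theorem for centred random vectors, the limit being described
by its characteristic function. -/
theorem tendstoInDistribution_inv_sqrt_smul_sum {E : Type*} [NormedAddCommGroup E]
    [InnerProductSpace ℝ E] [FiniteDimensional ℝ E] [MeasurableSpace E] [BorelSpace E]
    {X : ℕ → Ω → E} {Z : Ω' → E} (hZ : AEMeasurable Z P')
    (hZchar : ∀ t, charFun (P'.map Z) t =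
      Complex.exp (-((Var[fun ω => inner ℝ (X 0 ω) t; P] : ℝ) : ℂ) / 2))
    (hX : MemLp (X 0) 2 P) (h0 : ∀ t, P[fun ω => inner ℝ (X 0 ω) t] = 0)
    (hindep : iIndepFun X P) (hident : ∀ i, IdentDistrib (X i) (X 0) P P) :
    TendstoInDistribution (fun (n : ℕ) ω => (√n)⁻¹ • ∑ k ∈ Finset.range n, X k ω) atTop Z
      (fun _ => P) P' := by
  have mX : ∀ n : ℕ, AEMeasurable (fun ω => (√n)⁻¹ • ∑ k ∈ Finset.range n, X k ω) P := fun n =>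
    (Finset.aemeasurable_fun_sum _ fun k _ => (hident k).aemeasurable_fst).const_smul _
  refine ⟨mX, hZ, ?_⟩
  refine ProbabilityMeasure.tendsto_iff_tendsto_charFun.2 fun t => ?_
  have hg : Measurable fun x : E => inner ℝ x t := by fun_prop
  set v := Var[fun ω => inner ℝ (X 0 ω) t; P] with hv
  -- Cramér–Wold: the characteristic function at `t` is that of the projection onto `t` at `1`, so
  -- the one-dimensional theorem suffices.
  have key := (tendstoInDistribution_inv_sqrt_mul_sum_sub (P := P) (P' := gaussianReal 0 v.toNNReal)
    (Y := id) (X := fun k ω => inner ℝ (X k ω) t) HasLaw.id (hX.inner_const t)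
    (hindep.comp (fun _ x => inner ℝ x t) fun _ => hg)
    (fun i => (hident i).comp hg)).tendsto
  have key1 := (ProbabilityMeasure.tendsto_iff_tendsto_charFun.1 key) 1
  simp only [ProbabilityMeasure.coe_mk, Measure.map_id, charFun_gaussianReal] at key1
  simp only [ProbabilityMeasure.coe_mk, hZchar]
  convert key1 using 2 with n
  · simp only [charFun_apply, h0]
    rw [integral_map (mX n) (by fun_prop), integral_map _ (by fun_prop)]
    · simp [sum_inner, real_inner_smul_left]
    · have := hg.comp_aemeasurable (mX n)
      simpa [Function.comp_def, h0, sum_inner, real_inner_smul_left] using this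
  · simp [← hv, Real.coe_toNNReal v (variance_nonneg _ _), neg_div]

end CentralLimit

/-! ### Studentized sums and the chi-squared limit -/

section ChiSquared

open scoped Matrix MatrixOrder

variable {ι : Type*} [Fintype ι] [DecidableEq ι]

omit [DecidableEq ι] in
lemma map_norm_sq_stdGaussian {M : ℕ} (hM : Fintype.card ι = M) :
    (stdGaussian (EuclideanSpace ℝ ι)).map (fun z => ‖z‖ ^ 2) = chiSquared M := by
  have f : ι ≃ Fin M := Fintype.equivFinOfCardEq hM
  rw [← stdGaussian_map (LinearIsometryEquiv.piLpCongrLeft 2 ℝ ℝ f.symm), ← map_pi_eq_stdGaussian,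
    Measure.map_map (by fun_prop) (by fun_prop), Measure.map_map (by fun_prop) (by fun_prop),
    chiSquared]
  congr 1
  ext x
  simpa [EuclideanSpace.norm_sq_eq] using Equiv.sum_comp f fun i => x i ^ 2

/-- If `S` is positive definite then `zᵀ S⁻¹ z` with `z = √S w` is the squared norm of `w`. -/
lemma dotProduct_inv_mulVec_sqrt {S : Matrix ι ι ℝ} (hS : S.PosDef) (w : ι → ℝ) :
    (CFC.sqrt S *ᵥ w) ⬝ᵥ (S⁻¹ *ᵥ (CFC.sqrt S *ᵥ w)) = w ⬝ᵥ w := by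
  have hmul : CFC.sqrt S * CFC.sqrt S = S := CFC.sqrt_mul_sqrt_self S hS.posSemidef.nonneg
  have hsymm : (CFC.sqrt S)ᵀ = CFC.sqrt S := by
    have := (Matrix.nonneg_iff_posSemidef.1 (CFC.sqrt_nonneg S)).1
    simpa [Matrix.IsHermitian] using this
  have hunit : IsUnit (CFC.sqrt S).det := by
    have h : IsUnit (CFC.sqrt S * CFC.sqrt S).det := by
      rw [hmul]; exact (Matrix.isUnit_iff_isUnit_det _).1 hS.isUnit
    rw [Matrix.det_mul] at h
    exact isUnit_of_mul_isUnit_left h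
  have hinv : S⁻¹ = (CFC.sqrt S)⁻¹ * (CFC.sqrt S)⁻¹ := by
    rw [← Matrix.mul_inv_rev, hmul]
  rw [hinv, ← Matrix.mulVec_mulVec, Matrix.mulVec_mulVec w, Matrix.nonsing_inv_mul _ hunit,
    Matrix.one_mulVec, Matrix.dotProduct_mulVec, ← Matrix.mulVec_transpose,
    Matrix.transpose_nonsing_inv, hsymm, Matrix.mulVec_mulVec, Matrix.nonsing_inv_mul _ hunit,
    Matrix.one_mulVec]

variable {Ω : Type*} [MeasurableSpace Ω] {P : Measure Ω} [IsProbabilityMeasure P]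

/-- A normalised sum of centred i.i.d. vectors, studentized by a strongly consistent estimator of
the inverse covariance matrix, is asymptotically chi-squared. -/
theorem tendstoInDistribution_studentized {M : ℕ} (hM : Fintype.card ι = M)
    {X : ℕ → Ω → EuclideanSpace ℝ ι} {S : Matrix ι ι ℝ} (hS : S.PosDef)
    (hX : MemLp (X 0) 2 P) (h0 : ∀ t, P[fun ω => inner ℝ (X 0 ω) t] = 0)
    (hcov : ∀ t : EuclideanSpace ℝ ι, P[fun ω => inner ℝ (X 0 ω) t ^ 2] = t.ofLp ⬝ᵥ S *ᵥ t.ofLp)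
    (hindep : iIndepFun X P) (hident : ∀ i, IdentDistrib (X i) (X 0) P P)
    {H : ℕ → Ω → ι → ι → ℝ} (hHmeas : ∀ n, AEMeasurable (H n) P)
    (hH : ∀ᵐ ω ∂P, Tendsto (fun n => H n ω) atTop (𝓝 fun i j => S⁻¹ i j)) :
    TendstoInDistribution
      (fun (n : ℕ) ω => ((√n)⁻¹ • ∑ k ∈ Finset.range n, X k ω).ofLp ⬝ᵥ
        Matrix.of (H n ω) *ᵥ ((√n)⁻¹ • ∑ k ∈ Finset.range n, X k ω).ofLp)
      atTop id (fun _ => P) (chiSquared M) := by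
  have hclt := tendstoInDistribution_inv_sqrt_smul_sum (P := P)
    (P' := stdGaussian (EuclideanSpace ℝ ι)) (X := X)
    (Z := fun z => Matrix.toEuclideanCLM (𝕜 := ℝ) (CFC.sqrt S) z) (by fun_prop)
    (fun t => by
      have h : (stdGaussian (EuclideanSpace ℝ ι)).map
          (fun z => Matrix.toEuclideanCLM (𝕜 := ℝ) (CFC.sqrt S) z) = multivariateGaussian 0 S := by
        simp [multivariateGaussian]
      rw [h, charFun_multivariateGaussian hS.posSemidef, variance_of_integral_eq_zero
        ((hX.aestronglyMeasurable.aemeasurable).inner_const) (h0 t), ← hcov t]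
      simp [neg_div]) hX h0 hindep hident
  have hHm : TendstoInMeasure P H atTop fun _ => fun i j => S⁻¹ i j :=
    tendstoInMeasure_of_tendsto_ae (fun n => (hHmeas n).aestronglyMeasurable) hH
  have hg : Continuous fun p : EuclideanSpace ℝ ι × (ι → ι → ℝ) =>
      p.1.ofLp ⬝ᵥ Matrix.of p.2 *ᵥ p.1.ofLp := by
    simp only [dotProduct, Matrix.mulVec, Matrix.of_apply]
    fun_prop
  -- Slutsky: `H` tends in probability to a constant, so the pair converges jointly and the
  -- continuous quadratic form passes to the limit.
  have hlim := hclt.continuous_comp_prodMk_of_tendstoInMeasure_const hg hHm hHmeas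
  refine ⟨hlim.forall_aemeasurable, aemeasurable_id, ?_⟩
  convert! hlim.tendsto using 3
  refine congrArg 𝓝 (Subtype.ext ?_)
  refine (Measure.map_id.trans (map_norm_sq_stdGaussian hM).symm).trans ?_
  refine congrArg (fun g => Measure.map g (stdGaussian (EuclideanSpace ℝ ι))) ?_
  ext z
  have := dotProduct_inv_mulVec_sqrt hS z.ofLp
  simp only [Matrix.ofLp_toEuclideanCLM]
  refine Eq.trans ?_ this.symm
  simp only [EuclideanSpace.norm_sq_eq, dotProduct, Real.norm_eq_abs, sq_abs]
  exact Finset.sum_congr rfl fun i _ => sq _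

end ChiSquared

/-! ### Averages along moving directions, strong law, matrix inversion -/

section General

/-- As the observations lie in the unit ball, replacing `u n`, `v n` by their limits changes every
summand by at most one bound, uniform in `r` and tending to `0`. This allows directions that depend
on the sample itself. -/
lemma tendsto_average_inner_mul_inner {E F : Type*} [NormedAddCommGroup E] [InnerProductSpace ℝ E]
    [NormedAddCommGroup F] [InnerProductSpace ℝ F] {x : ℕ → E} {z : ℕ → F}
    (hx : ∀ r, ‖x r‖ ≤ 1) (hz : ∀ r, ‖z r‖ ≤ 1) {u : ℕ → E} {u₀ : E} {v : ℕ → F} {v₀ : F}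
    (hu : Tendsto u atTop (𝓝 u₀)) (hv : Tendsto v atTop (𝓝 v₀)) {c : ℝ}
    (h : Tendsto (fun n : ℕ => (n : ℝ)⁻¹ * ∑ r ∈ Finset.range n,
      inner ℝ u₀ (x r) * inner ℝ v₀ (z r)) atTop (𝓝 c)) :
    Tendsto (fun n : ℕ => (n : ℝ)⁻¹ * ∑ r ∈ Finset.range n,
      inner ℝ (u n) (x r) * inner ℝ (v n) (z r)) atTop (𝓝 c) := by
  have hbound : Tendsto (fun n => ‖u n - u₀‖ * ‖v n‖ + ‖u₀‖ * ‖v n - v₀‖) atTop (𝓝 0) := by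
    have h1 := ((hu.sub_const u₀).norm.mul hv.norm).add
      ((hv.sub_const v₀).norm.const_mul ‖u₀‖)
    simpa using h1
  have hdiff : Tendsto (fun n : ℕ => (n : ℝ)⁻¹ * ∑ r ∈ Finset.range n,
      (inner ℝ (u n) (x r) * inner ℝ (v n) (z r) - inner ℝ u₀ (x r) * inner ℝ v₀ (z r)))
      atTop (𝓝 0) := by
    refine squeeze_zero_norm (fun n => ?_) hbound
    have hterm : ∀ r, ‖inner ℝ (u n) (x r) * inner ℝ (v n) (z r) -
        inner ℝ u₀ (x r) * inner ℝ v₀ (z r)‖ ≤ ‖u n - u₀‖ * ‖v n‖ + ‖u₀‖ * ‖v n - v₀‖ := by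
      intro r
      have e1 : inner ℝ (u n) (x r) * inner ℝ (v n) (z r) - inner ℝ u₀ (x r) * inner ℝ v₀ (z r) =
          inner ℝ (u n - u₀) (x r) * inner ℝ (v n) (z r) +
            inner ℝ u₀ (x r) * inner ℝ (v n - v₀) (z r) := by
        rw [inner_sub_left, inner_sub_left]; ring
      have hxb : ∀ w : E, ‖inner ℝ w (x r)‖ ≤ ‖w‖ := fun w =>
        (norm_inner_le_norm _ _).trans (mul_le_of_le_one_right (norm_nonneg _) (hx r))
      have hzb : ∀ w : F, ‖inner ℝ w (z r)‖ ≤ ‖w‖ := fun w =>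
        (norm_inner_le_norm _ _).trans (mul_le_of_le_one_right (norm_nonneg _) (hz r))
      rw [e1]
      refine (norm_add_le _ _).trans ?_
      rw [norm_mul, norm_mul]
      gcongr <;> first | exact hxb _ | exact hzb _
    rw [norm_mul, norm_inv, Real.norm_natCast]
    rcases eq_or_ne n 0 with rfl | hn
    · simp only [Nat.cast_zero, inv_zero, zero_mul]; positivity
    · rw [inv_mul_le_iff₀ (by positivity)]
      refine (norm_sum_le _ _).trans ((Finset.sum_le_sum fun r _ => hterm r).trans ?_)
      simp only [Finset.sum_const, Finset.card_range, nsmul_eq_mul, le_refl]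
  have := hdiff.add h
  simpa [Finset.sum_sub_distrib, mul_sub] using this

variable {Ω : Type*} [MeasurableSpace Ω] {P : Measure Ω}

lemma ae_tendsto_average {𝓧 F : Type*} [MeasurableSpace 𝓧] [NormedAddCommGroup F]
    [NormedSpace ℝ F] [CompleteSpace F] [MeasurableSpace F] [BorelSpace F]
    {Q : Measure 𝓧} {Y : ℕ → Ω → 𝓧} (hlaw : ∀ r, HasLaw (Y r) Q P) (hindep : iIndepFun Y P)
    {f : 𝓧 → F} (hf : Measurable f) (hint : Integrable f Q) :
    ∀ᵐ ω ∂P, Tendsto (fun n : ℕ => (n : ℝ)⁻¹ • ∑ r ∈ Finset.range n, f (Y r ω)) atTop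
      (𝓝 (∫ y, f y ∂Q)) := by
  have hident : ∀ i, IdentDistrib (Y i) (Y 0) P P := fun i =>
    ⟨(hlaw i).aemeasurable, (hlaw 0).aemeasurable, by rw [(hlaw i).map_eq, (hlaw 0).map_eq]⟩
  have hint0 : Integrable (f ∘ Y 0) P := by
    have h := hint
    rw [← (hlaw 0).map_eq] at h
    exact h.comp_aemeasurable (hlaw 0).aemeasurable
  have h := strong_law_ae (fun r => f ∘ Y r) hint0
    (fun i j hij => (hindep.indepFun hij).comp hf hf) fun i => (hident i).comp hf
  have hE : P[f ∘ Y 0] = ∫ y, f y ∂Q := (hlaw 0).integral_comp hint.aestronglyMeasurable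
  rw [hE] at h
  exact h

lemma measurable_nonsing_inv {ι : Type*} [Fintype ι] [DecidableEq ι] :
    Measurable fun A : ι → ι → ℝ => fun s t => (Matrix.of A)⁻¹ s t := by
  have hof : Continuous fun A : ι → ι → ℝ => Matrix.of A := continuous_id
  have hdet : Measurable fun A : ι → ι → ℝ => (Matrix.of A).det := hof.matrix_det.measurable
  refine measurable_pi_lambda _ fun s => measurable_pi_lambda _ fun t => ?_
  have hadj : Measurable fun A : ι → ι → ℝ => (Matrix.of A).adjugate s t :=
    (hof.matrix_adjugate.matrix_elem s t).measurable
  simp only [Matrix.inv_def, Matrix.smul_apply, Ring.inverse_eq_inv', smul_eq_mul]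
  exact hdet.inv.mul hadj

end General

/-! ### Algebra of the statistic for a fixed sample -/

section Deterministic

variable {m q : ℕ}

/-- The frames are arbitrary off `U ∩ S^m`. Extending them by zero makes them globally measurable
and keeps the values that matter. -/
lemma IsOrthonormalFrameOn.indicator {U : Set (Amb m)} {e : Fin m → Amb m → Amb m}
    (he : IsOrthonormalFrameOn U e) :
    IsOrthonormalFrameOn U fun i => (U ∩ Metric.sphere 0 1).indicator (e i) where
  continuousOn i := (he.continuousOn i).congr fun x hx => Set.indicator_of_mem hx _
  tangent x hx i := by
    simpa only [Set.indicator_of_mem hx] using he.tangent x hx i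
  orthonormal x hx := by
    simpa only [Set.indicator_of_mem hx] using he.orthonormal x hx

lemma IsOrthonormalFrameOn.measurable_indicator {U : Set (Amb m)} {e : Fin m → Amb m → Amb m}
    (he : IsOrthonormalFrameOn U e) (hU : IsOpen U) (i : Fin m) :
    Measurable ((U ∩ Metric.sphere 0 1).indicator (e i)) := by
  classical
  rw [← Set.piecewise_eq_indicator]
  exact (he.continuousOn i).measurable_piecewise continuousOn_const
    (hU.measurableSet.inter Metric.isClosed_sphere.measurableSet)

lemma inv_norm_smul_mem_sphere {x : Amb m} (hx : x ≠ 0) :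
    ‖x‖⁻¹ • x ∈ Metric.sphere (0 : Amb m) 1 := by
  simp [norm_smul, hx]

/-- The tangential coordinates of an observation with respect to the frames at `p`. -/
noncomputable def tangentCoord (e : Fin q → Fin m → Amb m → Amb m) (p : Fin q → Amb m)
    (y : Fin q → Sph m) : EuclideanSpace ℝ (Fin q × Fin m) :=
  WithLp.toLp 2 fun s => inner ℝ (e s.1 s.2 (p s.1)) (y s.1 : Amb m)

/-- The empirical second moment matrix of the tangential coordinates at the directional sample
mean. -/
noncomputable def tangentGram (e : Fin q → Fin m → Amb m → Amb m) (y : ℕ → Fin q → Sph m) (n : ℕ) :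
    Matrix (Fin q × Fin m) (Fin q × Fin m) ℝ :=
  Matrix.of fun s t => (n : ℝ)⁻¹ * ∑ r ∈ Finset.range n,
    inner ℝ (e s.1 s.2 (sampleDir y n s.1)) (y r s.1 : Amb m) *
      inner ℝ (e t.1 t.2 (sampleDir y n t.1)) (y r t.1 : Amb m)

/-- The covariance matrix of the tangential coordinates at the mean direction. -/
noncomputable def tangentCov (Q : Measure (Fin q → Sph m)) (e : Fin q → Fin m → Amb m → Amb m) :
    Matrix (Fin q × Fin m) (Fin q × Fin m) ℝ :=
  Matrix.of fun s t => ∫ y, tangentCoord e (meanDir Q) y s * tangentCoord e (meanDir Q) y t ∂Q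

variable {e : Fin q → Fin m → Amb m → Amb m} {y : ℕ → Fin q → Sph m} {n : ℕ}

lemma studG_eq_diagonal_mul : studG e y n =
    Matrix.diagonal (fun s => ‖sampleMean y n s.1‖⁻¹) * tangentGram e y n *
      Matrix.diagonal fun s => ‖sampleMean y n s.1‖⁻¹ := by
  ext s t
  simp only [studG, tangentGram, Matrix.mul_diagonal, Matrix.diagonal_mul, Matrix.of_apply, mul_inv]
  ring

lemma isUnit_det_studG_iff (hy : ∀ a, sampleMean y n a ≠ 0) :
    IsUnit (studG e y n).det ↔ (tangentGram e y n).det ≠ 0 := by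
  simp [studG_eq_diagonal_mul, Matrix.det_mul, Matrix.det_diagonal, Finset.prod_ne_zero_iff, hy,
    isUnit_iff_ne_zero]

/-- The diagonal factor in `d` cancels its inverses on both sides of `(studG e y n)⁻¹`. -/
lemma studStat_eq (hy : ∀ a, sampleMean y n a ≠ 0) {p : Fin q → Amb m} {d : Fin q × Fin m → ℝ}
    (hd : ∀ s, d s = ‖sampleMean y n s.1‖⁻¹ * inner ℝ (e s.1 s.2 (p s.1)) (sampleMean y n s.1)) :
    studStat e y n d =
      ((√n)⁻¹ • ∑ r ∈ Finset.range n, tangentCoord e p (y r)).ofLp ⬝ᵥ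
        Matrix.mulVec (tangentGram e y n)⁻¹
          ((√n)⁻¹ • ∑ r ∈ Finset.range n, tangentCoord e p (y r)).ofLp := by
  set T : Fin q × Fin m → ℝ := (∑ r ∈ Finset.range n, tangentCoord e p (y r)).ofLp with hT
  set C : Matrix (Fin q × Fin m) (Fin q × Fin m) ℝ :=
    Matrix.diagonal fun s => ‖sampleMean y n s.1‖⁻¹ with hC
  have hdT : d = Matrix.mulVec C ((n : ℝ)⁻¹ • T) := by
    ext s
    simp [hd, hC, Matrix.mulVec_diagonal, hT, sampleMean, tangentCoord, inner_smul_right, inner_sum]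
  have hCdet : IsUnit C.det := by
    simp [hC, Matrix.det_diagonal, Finset.prod_ne_zero_iff, hy, isUnit_iff_ne_zero]
  have hCT : C.transpose = C := Matrix.diagonal_transpose _
  have hmid : d ⬝ᵥ Matrix.mulVec (studG e y n)⁻¹ d =
      ((n : ℝ)⁻¹ • T) ⬝ᵥ Matrix.mulVec (tangentGram e y n)⁻¹ ((n : ℝ)⁻¹ • T) := by
    rw [studG_eq_diagonal_mul, ← hC, Matrix.mul_inv_rev, Matrix.mul_inv_rev, hdT,
      ← Matrix.mulVec_mulVec, ← Matrix.mulVec_mulVec, Matrix.mulVec_mulVec _ C⁻¹ C,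
      Matrix.nonsing_inv_mul _ hCdet, Matrix.one_mulVec, Matrix.dotProduct_mulVec _ C⁻¹,
      ← Matrix.mulVec_transpose, Matrix.transpose_nonsing_inv, hCT, Matrix.mulVec_mulVec,
      Matrix.nonsing_inv_mul _ hCdet, Matrix.one_mulVec]
  -- This also holds at `n = 0`, where both sides are `0`.
  have hn : (n : ℝ) * ((n : ℝ)⁻¹ * (n : ℝ)⁻¹) = (√n)⁻¹ * (√n)⁻¹ := by
    rw [← mul_inv, ← mul_inv, Real.mul_self_sqrt n.cast_nonneg]
    rcases eq_or_ne (n : ℝ) 0 with h | h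
    · simp [h]
    · field_simp
  simp only [studStat, hmid, WithLp.ofLp_smul, ← hT, Matrix.mulVec_smul, smul_dotProduct,
    dotProduct_smul, smul_eq_mul]
  rw [← mul_assoc, ← mul_assoc, ← mul_assoc, mul_assoc (n : ℝ), hn]

/-- Pairing the decomposition with `f j p` kills `ν` and also `p`, so `x` itself appears instead of
`x - p`. -/
lemma frame_coefficient_eq {U : Set (Amb m)} {f : Fin m → Amb m → Amb m}
    (hf : IsOrthonormalFrameOn U f) {p x ν : Amb m} (hp : p ∈ U ∩ Metric.sphere 0 1)
    {c : Fin m → ℝ} (hdecomp : x - p = ∑ j, c j • f j p + ν)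
    (hν : ∀ w : Amb m, inner ℝ w p = 0 → inner ℝ w ν = 0) (j : Fin m) :
    c j = inner ℝ (f j p) x := by
  have htan := hf.tangent p hp j
  have h := congrArg (fun w => inner ℝ (f j p) w) hdecomp
  simp only [inner_sub_right, inner_add_right, htan, sub_zero, hν _ htan, add_zero] at h
  rw [h, (hf.orthonormal p hp).inner_right_fintype]

lemma sampleDir_mem {U : Set (Amb m)} {a : Fin q} (hy : sampleMean y n a ≠ 0)
    (hU : sampleDir y n a ∈ U) : sampleDir y n a ∈ U ∩ Metric.sphere 0 1 :=
  ⟨hU, inv_norm_smul_mem_sphere hy⟩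

lemma studG_indicator {U : Fin q → Set (Amb m)}
    (hy : ∀ a, sampleMean y n a ≠ 0 ∧ sampleDir y n a ∈ U a) :
    studG (fun a j => (U a ∩ Metric.sphere 0 1).indicator (e a j)) y n = studG e y n := by
  ext s t
  simp only [studG, Matrix.of_apply,
    Set.indicator_of_mem (sampleDir_mem (hy s.1).1 (hy s.1).2),
    Set.indicator_of_mem (sampleDir_mem (hy t.1).1 (hy t.1).2)]

lemma statDefined_indicator_iff {U : Fin q → Set (Amb m)} :
    StatDefined U (fun a j => (U a ∩ Metric.sphere 0 1).indicator (e a j)) y n ↔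
      StatDefined U e y n :=
  and_congr_right fun h => by rw [studG_indicator h]

lemma statDefined_iff {U : Fin q → Set (Amb m)} :
    StatDefined U e y n ↔
      (∀ a, sampleMean y n a ≠ 0 ∧ sampleDir y n a ∈ U a) ∧ (tangentGram e y n).det ≠ 0 :=
  and_congr_right fun h => isUnit_det_studG_iff fun a => (h a).1

end Deterministic

/-! ### Measurability in the sample -/

section Measurability

variable {m q : ℕ}

lemma measurable_coord (r : ℕ) (a : Fin q) :
    Measurable fun y : ℕ → Fin q → Sph m => (y r a : Amb m) :=
  measurable_subtype_coe.comp ((measurable_pi_apply a).comp (measurable_pi_apply r))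

lemma measurable_sampleMean (n : ℕ) (a : Fin q) :
    Measurable fun y : ℕ → Fin q → Sph m => sampleMean y n a := by
  have h : Measurable fun y : ℕ → Fin q → Sph m => ∑ r ∈ Finset.range n, (y r a : Amb m) :=
    Finset.measurable_sum _ fun r _ => measurable_coord r a
  exact h.const_smul (n : ℝ)⁻¹

lemma measurable_sampleDir (n : ℕ) (a : Fin q) :
    Measurable fun y : ℕ → Fin q → Sph m => sampleDir y n a :=
  (measurable_sampleMean n a).norm.inv.smul (measurable_sampleMean n a)

variable {e : Fin q → Fin m → Amb m → Amb m}

lemma measurable_tangentGram (he : ∀ a j, Measurable (e a j)) (n : ℕ) :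
    Measurable fun y : ℕ → Fin q → Sph m => fun s t => tangentGram e y n s t := by
  refine measurable_pi_lambda _ fun s => measurable_pi_lambda _ fun t => ?_
  have h : ∀ (s : Fin q × Fin m) (r : ℕ), Measurable fun y : ℕ → Fin q → Sph m =>
      inner ℝ (e s.1 s.2 (sampleDir y n s.1)) (y r s.1 : Amb m) := fun s r =>
    ((he s.1 s.2).comp (measurable_sampleDir n s.1)).inner (measurable_coord r s.1)
  exact (Finset.measurable_sum _ fun r _ => (h s r).mul (h t r)).const_mul _

lemma measurableSet_statDefined (he : ∀ a j, Measurable (e a j)) {U : Fin q → Set (Amb m)}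
    (hU : ∀ a, IsOpen (U a)) (n : ℕ) :
    MeasurableSet {y : ℕ → Fin q → Sph m | StatDefined U e y n} := by
  simp only [statDefined_iff, Set.ofPred_and, Set.ofPred_forall]
  refine (MeasurableSet.iInter fun a => ?_).inter ?_
  · exact ((measurable_sampleMean n a) (measurableSet_singleton 0).compl).inter
      ((measurable_sampleDir n a) (hU a).measurableSet)
  · have hof : Continuous fun A : Fin q × Fin m → Fin q × Fin m → ℝ => Matrix.of A := continuous_id
    exact (hof.matrix_det.measurable.comp (measurable_tangentGram he n))
      (measurableSet_singleton 0).compl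

open scoped Classical in
/-- The inverse of the empirical second moment matrix, set to `0` where the statistic is not
defined. -/
noncomputable def tangentGramInv (U : Fin q → Set (Amb m)) (e : Fin q → Fin m → Amb m → Amb m)
    (n : ℕ) (y : ℕ → Fin q → Sph m) : Fin q × Fin m → Fin q × Fin m → ℝ :=
  if StatDefined U e y n then fun s t => (tangentGram e y n)⁻¹ s t else 0

lemma measurable_tangentGramInv (he : ∀ a j, Measurable (e a j)) {U : Fin q → Set (Amb m)}
    (hU : ∀ a, IsOpen (U a)) (n : ℕ) : Measurable (tangentGramInv U e n) :=
  Measurable.ite (measurableSet_statDefined he hU n)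
    (measurable_nonsing_inv.comp (measurable_tangentGram he n)) measurable_const

end Measurability

/-! ### Moments of the tangential coordinates and consistency -/

section Limits

variable {m q : ℕ} {e : Fin q → Fin m → Amb m → Amb m} {U : Fin q → Set (Amb m)}
  {Q : Measure (Fin q → Sph m)}

lemma continuous_tangentCoord (p : Fin q → Amb m) : Continuous (tangentCoord e p) := by
  unfold tangentCoord
  fun_prop

lemma inner_tangentCoord (p : Fin q → Amb m) (y : Fin q → Sph m)
    (t : EuclideanSpace ℝ (Fin q × Fin m)) :
    inner ℝ (tangentCoord e p y) t = ∑ s, t s * inner ℝ (e s.1 s.2 (p s.1)) (y s.1 : Amb m) := by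
  rw [PiLp.inner_apply]
  rfl

lemma integrable_of_continuous [IsFiniteMeasure Q] {F : Type*} [NormedAddCommGroup F]
    {f : (Fin q → Sph m) → F} (hf : Continuous f) : Integrable f Q :=
  hf.integrable_of_hasCompactSupport (HasCompactSupport.of_compactSpace f)

lemma meanDir_mem (hmean : ∀ a, meanVec Q a ≠ 0) (hU : ∀ a, meanDir Q a ∈ U a) (a : Fin q) :
    meanDir Q a ∈ U a ∩ Metric.sphere 0 1 :=
  ⟨hU a, inv_norm_smul_mem_sphere (hmean a)⟩

/-- The mean `μ^a` is a multiple of the mean direction, to which the frame is orthogonal. So the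
coordinates are centred and their second moments are covariances. -/
lemma integral_inner_tangentCoord [IsFiniteMeasure Q] (hmean : ∀ a, meanVec Q a ≠ 0)
    (hU : ∀ a, meanDir Q a ∈ U a) (he : ∀ a, IsOrthonormalFrameOn (U a) (e a))
    (t : EuclideanSpace ℝ (Fin q × Fin m)) :
    ∫ y, inner ℝ (tangentCoord e (meanDir Q) y) t ∂Q = 0 := by
  have hcont : ∀ a : Fin q, Continuous fun y : Fin q → Sph m => (y a : Amb m) := fun a => by
    fun_prop
  simp only [inner_tangentCoord]
  rw [integral_finsetSum _ fun s _ => integrable_of_continuous (by fun_prop)]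
  refine Finset.sum_eq_zero fun s _ => ?_
  have h0 : inner ℝ (e s.1 s.2 (meanDir Q s.1)) (meanVec Q s.1) = 0 := by
    have h := (he s.1).tangent _ (meanDir_mem hmean hU s.1) s.2
    have hn : ‖meanVec Q s.1‖⁻¹ ≠ 0 := inv_ne_zero (norm_ne_zero_iff.2 (hmean s.1))
    nth_rewrite 2 [meanDir] at h
    rw [inner_smul_right] at h
    exact (mul_eq_zero.1 h).resolve_left hn
  have h1 : ∫ y : Fin q → Sph m, inner ℝ (e s.1 s.2 (meanDir Q s.1)) (y s.1 : Amb m) ∂Q = 0 := by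
    rw [integral_inner (integrable_of_continuous (hcont s.1)), ← meanVec, h0]
  rw [integral_const_mul, h1, mul_zero]

lemma integral_inner_tangentCoord_sq [IsFiniteMeasure Q]
    (t : EuclideanSpace ℝ (Fin q × Fin m)) :
    ∫ y, inner ℝ (tangentCoord e (meanDir Q) y) t ^ 2 ∂Q =
      t.ofLp ⬝ᵥ Matrix.mulVec (tangentCov Q e) t.ofLp := by
  have hc := continuous_tangentCoord (e := e) (meanDir Q)
  have hcs : ∀ s, Continuous fun y => tangentCoord e (meanDir Q) y s := fun s => by fun_prop
  have hexp : ∀ y, inner ℝ (tangentCoord e (meanDir Q) y) t ^ 2 =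
      ∑ s, ∑ r, t s * t r *
        (tangentCoord e (meanDir Q) y s * tangentCoord e (meanDir Q) y r) := fun y => by
    rw [sq, PiLp.inner_apply, Finset.sum_mul_sum]
    refine Finset.sum_congr rfl fun s _ => Finset.sum_congr rfl fun r _ => ?_
    simp only [RCLike.inner_apply, conj_trivial]
    ring
  simp only [hexp]
  rw [integral_finsetSum _ fun s _ => integrable_of_continuous (by fun_prop)]
  simp only [dotProduct, Matrix.mulVec, Finset.mul_sum]
  refine Finset.sum_congr rfl fun s _ => ?_
  rw [integral_finsetSum _ fun r _ => integrable_of_continuous (by fun_prop)]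
  refine Finset.sum_congr rfl fun r _ => ?_
  rw [integral_const_mul, tangentCov, Matrix.of_apply]
  ring

/-- The quadratic form at `x` is a second moment. If it vanishes, the tangent vectors with frame
coordinates `x` violate nondegeneracy unless they are zero, and orthonormality then gives `x = 0`.
-/
lemma posDef_tangentCov [IsFiniteMeasure Q] (hmean : ∀ a, meanVec Q a ≠ 0)
    (hnondeg : ∀ v : Fin q → Amb m, (∀ a, inner ℝ (v a) (meanDir Q a) = 0) →
      (∀ᵐ y ∂Q, ∑ a, inner ℝ (v a) (y a : Amb m) = 0) → v = 0)
    (hU : ∀ a, meanDir Q a ∈ U a) (he : ∀ a, IsOrthonormalFrameOn (U a) (e a)) :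
    (tangentCov Q e).PosDef := by
  refine Matrix.PosDef.of_dotProduct_mulVec_pos ?_ fun x hx => ?_
  · ext s t
    simp [tangentCov, mul_comm]
  have hquad := integral_inner_tangentCoord_sq (Q := Q) (e := e) (WithLp.toLp 2 x)
  have hc := continuous_tangentCoord (e := e) (meanDir Q)
  rw [star_trivial]
  refine lt_of_le_of_ne (hquad ▸ integral_nonneg fun y => sq_nonneg _) fun h0 => hx ?_
  rw [← h0, integral_eq_zero_iff_of_nonneg (fun y => sq_nonneg _)
    (integrable_of_continuous ((hc.inner continuous_const).pow 2))] at hquad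
  have hv := hnondeg (fun a => ∑ j, x (a, j) • e a j (meanDir Q a))
    (fun a => by
      simp [sum_inner, inner_smul_left, (he a).tangent _ (meanDir_mem hmean hU a)])
    (by
      filter_upwards [hquad] with y hy
      have hy' : inner ℝ (tangentCoord e (meanDir Q) y) (WithLp.toLp 2 x) = 0 := by simpa using hy
      rw [← hy', inner_tangentCoord, Fintype.sum_prod_type]
      simp only [sum_inner, inner_smul_left, conj_trivial])
  ext s
  have hs := (((he s.1).orthonormal _ (meanDir_mem hmean hU s.1)).inner_right_fintype
    (fun j => x (s.1, j)) s.2).symm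
  rw [congrFun hv s.1] at hs
  simpa using hs

lemma tendsto_sampleDir {y : ℕ → Fin q → Sph m} {a : Fin q} (hmean : meanVec Q a ≠ 0)
    (h : Tendsto (fun n => sampleMean y n a) atTop (𝓝 (meanVec Q a))) :
    Tendsto (fun n => sampleDir y n a) atTop (𝓝 (meanDir Q a)) :=
  (h.norm.inv₀ (norm_ne_zero_iff.2 hmean)).smul h

lemma tendsto_tangentGram {y : ℕ → Fin q → Sph m} (hmean : ∀ a, meanVec Q a ≠ 0)
    (hUo : ∀ a, IsOpen (U a)) (hU : ∀ a, meanDir Q a ∈ U a)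
    (he : ∀ a, IsOrthonormalFrameOn (U a) (e a))
    (hsm : ∀ a, Tendsto (fun n => sampleMean y n a) atTop (𝓝 (meanVec Q a)))
    (hcov : ∀ s t, Tendsto (fun n : ℕ => (n : ℝ)⁻¹ • ∑ r ∈ Finset.range n,
      tangentCoord e (meanDir Q) (y r) s * tangentCoord e (meanDir Q) (y r) t) atTop
      (𝓝 (tangentCov Q e s t))) :
    Tendsto (fun n => tangentGram e y n) atTop (𝓝 (tangentCov Q e)) := by
  have hdir := fun a => tendsto_sampleDir (hmean a) (hsm a)
  have hframe : ∀ a j, Tendsto (fun n => e a j (sampleDir y n a)) atTop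
      (𝓝 (e a j (meanDir Q a))) := fun a j => by
    -- The frame is continuous only within `U a ∩ S^m`, so the sample direction must eventually lie
    -- there.
    refine Tendsto.comp ((he a).continuousOn j _ (meanDir_mem hmean hU a))
      (tendsto_nhdsWithin_iff.2 ⟨hdir a, ?_⟩)
    filter_upwards [(hdir a).eventually_mem ((hUo a).mem_nhds (hU a)),
      (hsm a).eventually_ne (hmean a)] with n h1 h2
    exact sampleDir_mem h2 h1
  refine tendsto_pi_nhds.2 fun s => tendsto_pi_nhds.2 fun t => ?_
  exact tendsto_average_inner_mul_inner (fun r => by simp) (fun r => by simp)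
    (hframe s.1 s.2) (hframe t.1 t.2) (hcov s t)

lemma eventually_statDefined {y : ℕ → Fin q → Sph m} (hmean : ∀ a, meanVec Q a ≠ 0)
    (hUo : ∀ a, IsOpen (U a)) (hU : ∀ a, meanDir Q a ∈ U a)
    (hsm : ∀ a, Tendsto (fun n => sampleMean y n a) atTop (𝓝 (meanVec Q a)))
    (hgram : Tendsto (fun n => tangentGram e y n) atTop (𝓝 (tangentCov Q e)))
    (hdet : (tangentCov Q e).det ≠ 0) : ∀ᶠ n in atTop, StatDefined U e y n := by
  have hdir := fun a => tendsto_sampleDir (hmean a) (hsm a)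
  simp only [statDefined_iff]
  refine (eventually_all.2 fun a => ((hsm a).eventually_ne (hmean a)).and
    ((hdir a).eventually_mem ((hUo a).mem_nhds (hU a)))).and ?_
  exact ((continuous_id.matrix_det.tendsto _).comp hgram).eventually_ne hdet

lemma tendsto_tangentGramInv {y : ℕ → Fin q → Sph m}
    (hgram : Tendsto (fun n => tangentGram e y n) atTop (𝓝 (tangentCov Q e)))
    (hdet : (tangentCov Q e).det ≠ 0) (hdef : ∀ᶠ n in atTop, StatDefined U e y n) :
    Tendsto (fun n => tangentGramInv U e n y) atTop
      (𝓝 fun s t => (tangentCov Q e)⁻¹ s t) := by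
  have hdetlim : Tendsto (fun n => (tangentGram e y n).det) atTop (𝓝 (tangentCov Q e).det) :=
    (continuous_id.matrix_det.tendsto _).comp hgram
  have hinv : Tendsto (fun n => (tangentGram e y n)⁻¹) atTop (𝓝 (tangentCov Q e)⁻¹) := by
    simp only [Matrix.inv_def, Ring.inverse_eq_inv']
    exact (hdetlim.inv₀ hdet).smul ((continuous_id.matrix_adjugate.tendsto _).comp hgram)
  refine Tendsto.congr' ?_ hinv
  filter_upwards [hdef] with n hn
  rw [tangentGramInv, if_pos hn]

end Limits

/-! ### The limit theorem -/

section Main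

variable {m q : ℕ} {Ω : Type*} [MeasurableSpace Ω] {P : Measure Ω} [IsProbabilityMeasure P]
  {Q : Measure (Fin q → Sph m)} [IsProbabilityMeasure Q] {Y : ℕ → Ω → Fin q → Sph m}
  {U : Fin q → Set (Amb m)} {e : Fin q → Fin m → Amb m → Amb m}

omit [IsProbabilityMeasure P] in
lemma ae_tendsto_moments (hYlaw : ∀ r, HasLaw (Y r) Q P) (hYindep : iIndepFun Y P) :
    ∀ᵐ ω ∂P, (∀ a, Tendsto (fun n => sampleMean (fun r => Y r ω) n a) atTop (𝓝 (meanVec Q a))) ∧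
      ∀ s t, Tendsto (fun n : ℕ => (n : ℝ)⁻¹ • ∑ r ∈ Finset.range n,
        tangentCoord e (meanDir Q) (Y r ω) s * tangentCoord e (meanDir Q) (Y r ω) t) atTop
        (𝓝 (tangentCov Q e s t)) := by
  refine (ae_all_iff.2 fun a => ?_).and (ae_all_iff.2 fun s => ae_all_iff.2 fun t => ?_)
  · have hc : Continuous fun y : Fin q → Sph m => (y a : Amb m) := by fun_prop
    have h := ae_tendsto_average (f := fun y => (y a : Amb m)) hYlaw hYindep hc.measurable
      (integrable_of_continuous hc)
    simpa only [sampleMean, meanVec] using h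
  · have hc : Continuous fun y : Fin q → Sph m =>
        tangentCoord e (meanDir Q) y s * tangentCoord e (meanDir Q) y t := by
      have := continuous_tangentCoord (e := e) (meanDir Q)
      fun_prop
    exact ae_tendsto_average hYlaw hYindep hc.measurable (integrable_of_continuous hc)

omit [IsProbabilityMeasure P] in
lemma ae_eventually_statDefined_and_tendsto (hYlaw : ∀ r, HasLaw (Y r) Q P)
    (hYindep : iIndepFun Y P) (hmean : ∀ a, meanVec Q a ≠ 0) (hUo : ∀ a, IsOpen (U a))
    (hU : ∀ a, meanDir Q a ∈ U a) (he : ∀ a, IsOrthonormalFrameOn (U a) (e a))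
    (hdet : (tangentCov Q e).det ≠ 0) :
    ∀ᵐ ω ∂P, (∀ᶠ n in atTop, StatDefined U e (fun r => Y r ω) n) ∧
      Tendsto (fun n => tangentGramInv U e n fun r => Y r ω) atTop
        (𝓝 fun s t => (tangentCov Q e)⁻¹ s t) := by
  filter_upwards [ae_tendsto_moments (e := e) hYlaw hYindep] with ω ⟨hsm, hcov⟩
  have hgram := tendsto_tangentGram hmean hUo hU he hsm hcov
  have hdef := eventually_statDefined hmean hUo hU hsm hgram hdet
  exact ⟨hdef, tendsto_tangentGramInv hgram hdet hdef⟩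

/-- The `A n` need not be measurable; measurable hulls have the same measure. -/
lemma tendsto_measure_of_ae_eventually {A : ℕ → Set Ω}
    (h : ∀ᵐ ω ∂P, ∀ᶠ n in atTop, ω ∈ A n) : Tendsto (fun n => P (A n)) atTop (𝓝 1) := by
  have hlim := tendsto_measure_of_ae_tendsto_indicator_of_isFiniteMeasure (μ := P) atTop
    (A := Set.univ) (As := fun n => toMeasurable P (A n)) MeasurableSet.univ
    (fun n => measurableSet_toMeasurable P (A n)) (by
      filter_upwards [h] with ω hω
      filter_upwards [hω] with n hn
      simp [subset_toMeasurable P (A n) hn])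
  simpa using hlim

/-- The limit theorem for measurable frame fields. -/
theorem tendsto_studStat_of_measurable
    (hYlaw : ∀ r, HasLaw (Y r) Q P) (hYindep : iIndepFun Y P) (hmean : ∀ a, meanVec Q a ≠ 0)
    (hnondeg : ∀ v : Fin q → Amb m, (∀ a, inner ℝ (v a) (meanDir Q a) = 0) →
      (∀ᵐ y ∂Q, ∑ a, inner ℝ (v a) (y a : Amb m) = 0) → v = 0)
    (hUo : ∀ a, IsOpen (U a)) (hU : ∀ a, meanDir Q a ∈ U a)
    (he : ∀ a, IsOrthonormalFrameOn (U a) (e a)) (hemeas : ∀ a j, Measurable (e a j))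
    {d : ℕ → Ω → Fin q × Fin m → ℝ}
    (hd : ∀ n ω a j, d n ω (a, j) =
      inner ℝ (e a j (meanDir Q a)) (sampleDir (fun r => Y r ω) n a)) :
    Tendsto (fun n : ℕ => P {ω | StatDefined U e (fun r => Y r ω) n}) atTop (𝓝 1) ∧
      TendstoInDistribution
        (fun n : ℕ => Set.indicator {ω | StatDefined U e (fun r => Y r ω) n}
          fun ω => studStat e (fun r => Y r ω) n (d n ω))
        atTop id (fun _ => P) (chiSquared (m * q)) := by
  have hpos := posDef_tangentCov hmean hnondeg hU he
  have hdet : (tangentCov Q e).det ≠ 0 := hpos.det_pos.ne'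
  have hYseq : AEMeasurable (fun ω r => Y r ω) P :=
    aemeasurable_pi_lambda _ fun r => (hYlaw r).aemeasurable
  have hlim := ae_eventually_statDefined_and_tendsto hYlaw hYindep hmean hUo hU he hdet
  refine ⟨tendsto_measure_of_ae_eventually (hlim.mono fun ω h => h.1), ?_⟩
  have hc := continuous_tangentCoord (e := e) (meanDir Q)
  have hident : ∀ i, IdentDistrib (Y i) (Y 0) P P := fun i =>
    ⟨(hYlaw i).aemeasurable, (hYlaw 0).aemeasurable, by rw [(hYlaw i).map_eq, (hYlaw 0).map_eq]⟩
  have hL2 : MemLp (fun ω => tangentCoord e (meanDir Q) (Y 0 ω)) 2 P := by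
    obtain ⟨C, hC⟩ := (isCompact_range hc).isBounded.exists_norm_le
    exact MemLp.of_bound (hc.measurable.comp_aemeasurable
      (hYlaw 0).aemeasurable).aestronglyMeasurable C (ae_of_all _ fun ω => hC _ ⟨_, rfl⟩)
  have hstat := tendstoInDistribution_studentized (P := P) (ι := Fin q × Fin m) (M := m * q)
    (by simp [mul_comm]) (X := fun r ω => tangentCoord e (meanDir Q) (Y r ω)) hpos hL2
    (fun t => ((hYlaw 0).integral_comp
      (f := fun y => inner ℝ (tangentCoord e (meanDir Q) y) t)
      (Continuous.aestronglyMeasurable (by fun_prop))).trans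
        (integral_inner_tangentCoord hmean hU he t))
    (fun t => ((hYlaw 0).integral_comp
      (f := fun y => inner ℝ (tangentCoord e (meanDir Q) y) t ^ 2)
      (Continuous.aestronglyMeasurable (by fun_prop))).trans
        (integral_inner_tangentCoord_sq t))
    (hYindep.comp (fun _ => tangentCoord e (meanDir Q)) fun _ => hc.measurable)
    (fun i => (hident i).comp hc.measurable)
    (H := fun n ω => tangentGramInv U e n fun r => Y r ω)
    (fun n => (measurable_tangentGramInv hemeas hUo n).comp_aemeasurable hYseq)
    (hlim.mono fun ω h => h.2)
  -- The two statistics agree pointwise: where undefined, `tangentGramInv` is `0`, so the quadratic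
  -- form takes the default value `0`.
  refine hstat.congr (fun n => ae_of_all _ fun ω => ?_) EventuallyEq.rfl
  by_cases hdef : StatDefined U e (fun r => Y r ω) n
  · rw [Set.indicator_of_mem (s := {ω | StatDefined U e (fun r => Y r ω) n}) hdef,
      studStat_eq (p := meanDir Q) (fun a => (hdef.1 a).1) fun s => by
        rw [hd, sampleDir, inner_smul_right]]
    simp only [tangentGramInv, if_pos hdef]
    rfl
  · rw [Set.indicator_of_notMem (s := {ω | StatDefined U e (fun r => Y r ω) n}) hdef]
    simp only [tangentGramInv, if_neg hdef]
    simp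

end Main

end DirectionalStat

theorem theorem4p2 {m q : ℕ} {Ω : Type*} [MeasurableSpace Ω]
    (P : Measure Ω) [IsProbabilityMeasure P]
    (Q : Measure (Fin q → DirectionalStat.Sph m)) [IsProbabilityMeasure Q]
    -- an i.i.d. sample from `Q`
    (Y : ℕ → Ω → Fin q → DirectionalStat.Sph m)
    (hYlaw : ∀ r, HasLaw (Y r) Q P) (hYindep : iIndepFun Y P)
    -- the mean multivariate direction exists
    (hmean : ∀ a, DirectionalStat.meanVec Q a ≠ 0)
    -- the tangential part of `Q` at the mean direction has a nonsingular covariance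
    (hnondeg : ∀ v : Fin q → DirectionalStat.Amb m,
      (∀ a, inner ℝ (v a) (DirectionalStat.meanDir Q a) = 0) →
      (∀ᵐ y ∂Q, ∑ a, inner ℝ (v a) (y a : DirectionalStat.Amb m) = 0) → v = 0)
    -- orthonormal frame fields around the mean multivariate direction
    (U : Fin q → Set (DirectionalStat.Amb m)) (hUopen : ∀ a, IsOpen (U a))
    (hUmem : ∀ a, DirectionalStat.meanDir Q a ∈ U a)
    (e : Fin q → Fin m → DirectionalStat.Amb m → DirectionalStat.Amb m)
    (he : ∀ a, DirectionalStat.IsOrthonormalFrameOn (U a) (e a))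
    -- decomposition of the difference into tangential and normal components
    (d : ℕ → Ω → Fin q × Fin m → ℝ) (ν : ℕ → Ω → Fin q → DirectionalStat.Amb m)
    (hdecomp : ∀ n ω a,
      DirectionalStat.sampleDir (fun r => Y r ω) n a - DirectionalStat.meanDir Q a =
        ∑ j, d n ω (a, j) • e a j (DirectionalStat.meanDir Q a) + ν n ω a)
    (hnormal : ∀ n ω a (w : DirectionalStat.Amb m),
      inner ℝ w (DirectionalStat.meanDir Q a) = 0 → inner ℝ w (ν n ω a) = 0) :
    Tendsto (fun n : ℕ => P {ω | DirectionalStat.StatDefined U e (fun r => Y r ω) n})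
        atTop (𝓝 1) ∧
      TendstoInDistribution
        (fun n : ℕ => Set.indicator {ω | DirectionalStat.StatDefined U e (fun r => Y r ω) n}
          fun ω => DirectionalStat.studStat e (fun r => Y r ω) n (d n ω))
        atTop id (fun _ => P) (DirectionalStat.chiSquared (m * q)) := by

  have hmem := DirectionalStat.meanDir_mem hmean hUmem
  -- The measurable case is applied to the frames extended by zero; they agree with `e` at the mean
  -- direction and, where the statistic is defined, at the sample direction.
  have h := DirectionalStat.tendsto_studStat_of_measurable hYlaw hYindep hmean hnondeg hUopen hUmem
    (fun a => (he a).indicator) (fun a j => (he a).measurable_indicator (hUopen a) j) (d := d)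
    fun n ω a j => by
      rw [Set.indicator_of_mem (hmem a)]
      exact DirectionalStat.frame_coefficient_eq (he a) (hmem a) (c := fun j => d n ω (a, j))
        (hdecomp n ω a) (hnormal n ω a) j
  simp only [DirectionalStat.statDefined_indicator_iff] at h
  convert h using 3 with n
  ext ω
  by_cases hdef : DirectionalStat.StatDefined U e (fun r => Y r ω) n
  · simp [Set.indicator, hdef, DirectionalStat.studStat, DirectionalStat.studG_indicator hdef.1]
  · simp [Set.indicator, hdef]
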